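/- Let $S_0$ be a finite set and let $P=(p_{y,y'})$ be a stochastic matrix on $\mathbb Z^3\times S_0$ that is skip free, i.e. $p_{(x,j),(x',j')}\neq 0$ only if $x'-x\in\mathbb H^3$ with $\mathbb H=\{-1,0,1\}$, and space homogeneous, i.e. $p_{(x+k,j),(x'+k,j')}=p_{(x,j),(x',j')}$ for all $k\in\mathbb Z^3$. For $k\in\mathbb H^3$ put $A_k=(p_{(0,j),(k,j')})_{j,j'\in S_0}$, and for $z_1,z_2,z_3>0$ put $$A_{***}(z_1,z_2,z_3)=\sum_{k\in\mathbb H^3}z_1^{k_1}z_2^{k_2}z_3^{k_3}A_k .$$ Let $\chi(z_1,z_2,z_3)$ be the reciprocal of the convergence parameter $\sup\{t\ge 0:\sum_{n\ge 0}t^nA_{***}(z_1,z_2,z_3)^n<\infty\}$ of this matrix, let $\bar\Gamma=\{s\in\mathbb R^3:\chi(e^{s_1},e^{s_2},e^{s_3})\le 1\}$, and let $s_i^{\max}=\sup_{s\in\bar\Gamma}s_i$ for $i=1,2,3$. Let $\pi$ be the stationary probability distribution of $A_{***}(1,1,1)$ and let $$a_i=\pi\Big(-\sum_{k\in\mathbb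 H^3,\,k_i=-1}A_k+\sum_{k\in\mathbb H^3,\,k_i=1}A_k\Big)\mathbf e,\qquad i=1,2,3,$$ be the mean drifts, where $\mathbf e$ is the column vector of ones. Let $Q$ be the restriction of $P$ to $\mathbb S_+=\mathbb Z_+^3\times S_0$, and let $\tilde Q=(\tilde q_{y,y'})_{y,y'\in\mathbb S_+}=\sum_{n=0}^\infty Q^n$ be its fundamental matrix. Assume that 1. $a_1,a_2,a_3$ are all nonzero and at least one of them is negative; 2. $Q$ is irreducible and aperiodic; 3. for each $i\in\{1,2,3\}$, every row of the block of $Q$ that describes the transitions increasing the $i$-th coordinate by one (indexed by the two other coordinates, in $\mathbb Z_+^2$, and the phase) has at least one positive element. Then, for every $y\in\mathbb S_+$, all $x_1',x_2',x_3'\in\mathbb Z_+$ and every $j'\in S_0$, $$\limsup_{n\to\infty}\frac1n\log\tilde q_{y,(n,x_2',x_3',j')}\le -s_1^{\max},\quad \limsup_{n\to\infty}\frac1n\log\tilde q_{y,(x_1',n,x_3',j')}\le -s_2^{\max},\quad \limsup_{n\to\infty}\frac1n\log\tilde q_{y,(x_1',x_2',n,j')}\le -s_3^{\max}.$$ -/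

import Mathlib

open scoped ENNReal NNReal

noncomputable section

/-- The finite set `{-1, 0, 1}³` of possible level increments. -/
def incr3 : Finset (Fin 3 → ℤ) := Fintype.piFinset fun _ => {-1, 0, 1}

/-- The transition matrix of a three-dimensional skip-free Markov modulated random walk on
`ℤ³ × S₀` with phase set `S₀`: a stochastic matrix which is skip free and space homogeneous
in the level coordinates. -/
structure MMRW3 (S₀ : Type*) where
  /-- transition probabilities -/
  P : (Fin 3 → ℤ) × S₀ → (Fin 3 → ℤ) × S₀ → ℝ
  nonneg : ∀ y y', 0 ≤ P y y'
  hasSum_row : ∀ y, HasSum (P y) 1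
  skip_free : ∀ x j x' j', P (x, j) (x', j') ≠ 0 → x' - x ∈ incr3
  homogeneous : ∀ k x j x' j', P (x + k, j) (x' + k, j') = P (x, j) (x', j')

/-- Convergence parameter `sup {z ≥ 0 : ∑ₙ zⁿ Aⁿ < ∞}` (entrywise convergence) of a finite
nonnegative square matrix, as an extended nonnegative real. -/
def convParam {S : Type*} [Fintype S] [DecidableEq S] (A : Matrix S S ℝ) : ℝ≥0∞ :=
  ⨆ (z : ℝ≥0) (_ : ∀ i j, Summable fun n : ℕ => (z : ℝ) ^ n * (A ^ n) i j), (z : ℝ≥0∞)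

/-- Powers `Tⁿ` of a nonnegative matrix with arbitrary index set. -/
def infPow {Y : Type*} [DecidableEq Y] (T : Y → Y → ℝ≥0∞) : ℕ → Y → Y → ℝ≥0∞
  | 0, y, y' => if y = y' then 1 else 0
  | n + 1, y, y' => ∑' y'', infPow T n y y'' * T y'' y'

/-- Irreducibility of a nonnegative matrix. -/
def InfIrreducible {Y : Type*} [DecidableEq Y] (T : Y → Y → ℝ≥0∞) : Prop :=
  ∀ y y', ∃ n, 0 < infPow T n y y'

/-- Aperiodicity: for every state the greatest common divisor of the possible positive return
times is `1`. -/
def InfAperiodic {Y : Type*} [DecidableEq Y] (T : Y → Y → ℝ≥0∞) : Prop :=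
  ∀ y, ∀ d : ℕ, (∀ n, 0 < n → 0 < infPow T n y y → d ∣ n) → d = 1

/-- The fundamental matrix `∑ₙ Tⁿ`, with values in `[0, ∞]`. -/
def fundamental {Y : Type*} [DecidableEq Y] (T : Y → Y → ℝ≥0∞) (y y' : Y) : ℝ≥0∞ :=
  ∑' n, infPow T n y y'

namespace MMRW3

variable {S₀ : Type*}

/-- The block `A_k` of transition probabilities with level increment `k`. -/
def A (W : MMRW3 S₀) (k : Fin 3 → ℤ) : Matrix S₀ S₀ ℝ :=
  fun j j' => W.P (0, j) (k, j')

/-- The matrix function `A_{***}(z) = ∑_{k ∈ {-1,0,1}³} z₁^{k₁} z₂^{k₂} z₃^{k₃} A_k`. -/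
def Astar (W : MMRW3 S₀) (z : Fin 3 → ℝ) : Matrix S₀ S₀ ℝ :=
  ∑ k ∈ incr3, (∏ i, z i ^ k i) • W.A k

/-- The sum of the blocks `A_k` over all `k ∈ {-1,0,1}³` with `k_i = c`. -/
def marginal (W : MMRW3 S₀) (i : Fin 3) (c : ℤ) : Matrix S₀ S₀ ℝ :=
  ∑ k ∈ incr3 with k i = c, W.A k

/-- `p` is a stationary probability distribution of `A_{***}(1,1,1)`. -/
def IsStationary [Fintype S₀] (W : MMRW3 S₀) (p : S₀ → ℝ) : Prop :=
  (∀ j, 0 ≤ p j) ∧ ∑ j, p j = 1 ∧ Matrix.vecMul p (W.Astar 1) = p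

/-- The `i`-th mean drift with respect to the phase distribution `p`. -/
def drift [Fintype S₀] (W : MMRW3 S₀) (p : S₀ → ℝ) (i : Fin 3) : ℝ :=
  p ⬝ᵥ Matrix.mulVec (-W.marginal i (-1) + W.marginal i 1) 1

/-- Restriction `Q` of the transition matrix to the nonnegative states `ℤ₊³ × S₀`. -/
def Q (W : MMRW3 S₀) (y y' : (Fin 3 → ℕ) × S₀) : ℝ≥0∞ :=
  ENNReal.ofReal (W.P (fun i => (y.1 i : ℤ), y.2) (fun i => (y'.1 i : ℤ), y'.2))

/-- The fundamental matrix `∑ₙ Qⁿ`. -/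
def Qtilde [DecidableEq S₀] (W : MMRW3 S₀) : (Fin 3 → ℕ) × S₀ → (Fin 3 → ℕ) × S₀ → ℝ≥0∞ :=
  fundamental W.Q

/-- The block of `Q` that describes the transitions in which coordinate `i` increases by one;
rows and columns are indexed by the two other coordinates and the phase. -/
def upBlock (W : MMRW3 S₀) (i : Fin 3) (p p' : (Fin 2 → ℕ) × S₀) : ℝ≥0∞ :=
  W.Q (i.insertNth (α := fun _ => ℕ) 0 p.1, p.2) (i.insertNth (α := fun _ => ℕ) 1 p'.1, p'.2)

variable [Fintype S₀] [DecidableEq S₀]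

/-- `χ(z)`, the reciprocal of the convergence parameter of `A_{***}(z)`. -/
def chi (W : MMRW3 S₀) (z : Fin 3 → ℝ) : ℝ≥0∞ := (convParam (W.Astar z))⁻¹

/-- The set of `s ∈ ℝ³` with `χ(e^{s₁}, e^{s₂}, e^{s₃}) ≤ 1`. -/
def Gammabar (W : MMRW3 S₀) : Set (Fin 3 → ℝ) :=
  {s | W.chi (fun i => Real.exp (s i)) ≤ 1}

/-- The supremum of the `i`-th coordinate over `Gammabar`, as an extended real. -/
def smax (W : MMRW3 S₀) (i : Fin 3) : EReal := ⨆ s ∈ W.Gammabar, (s i : EReal)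

end MMRW3

end

/-! If `v > 0` and `A_{***}(e^s) v ≤ e^c v`, then `f(x, j) = e^{s·x} v_j` satisfies `Q f ≤ e^c f`,
so `Qⁿ(y, y') ≤ e^{cn} f(y) / f(y')`: decay at rate `s_i` in coordinate `i` of `y'`. Each `s` in
`Gammabar` admits such a `v` for every `c > 0` (`exists_superharmonic_of_mem_Gammabar`), but the
bound is then not summable in `n`. A negative drift supplies one point `s'` with factor `e^{-r}`, `r
> 0` (`exists_strict_superharmonic`). The weighted geometric mean of the two bounds, with weights `1
- t` and `t`, is summable in `n` once `c = t r`, and gives decay rate `(1 - t) s_i + t s'_i` for `∑ₙ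
Qⁿ`. Let `t → 0`, then take the supremum over `s`. -/

/-! ### Powers of nonnegative kernels -/

theorem tsum_infPow_mul_le {Y : Type*} [DecidableEq Y] {T : Y → Y → ℝ≥0∞} {f : Y → ℝ≥0∞}
    {ρ : ℝ≥0∞} (h : ∀ y, ∑' y', T y y' * f y' ≤ ρ * f y) (n : ℕ) (y : Y) :
    ∑' y', infPow T n y y' * f y' ≤ ρ ^ n * f y := by
  induction n with
  | zero =>
    simp only [infPow, pow_zero, one_mul]
    rw [tsum_eq_single y (by intro b hb; simp [hb.symm])]
    simp
  | succ n ih =>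
    calc ∑' y', infPow T (n + 1) y y' * f y'
        = ∑' y'', infPow T n y y'' * ∑' y', T y'' y' * f y' := by
          simp only [infPow, ← ENNReal.tsum_mul_right, ← ENNReal.tsum_mul_left]
          rw [ENNReal.tsum_comm]
          simp only [mul_assoc]
      _ ≤ ∑' y'', infPow T n y y'' * (ρ * f y'') := by gcongr; exact h _
      _ = ρ * ∑' y'', infPow T n y y'' * f y'' := by
          rw [← ENNReal.tsum_mul_left]; congr 1; ext; ring
      _ ≤ ρ * (ρ ^ n * f y) := by gcongr
      _ = ρ ^ (n + 1) * f y := by ring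

theorem mem_of_infPow_ne_zero {Y : Type*} [DecidableEq Y] {T : Y → Y → ℝ≥0∞} {M : Set Y}
    (h : ∀ y ∈ M, ∀ y', T y y' ≠ 0 → y' ∈ M) (n : ℕ) {y : Y} (hy : y ∈ M) (y' : Y)
    (hn : infPow T n y y' ≠ 0) : y' ∈ M := by
  induction n generalizing y' with
  | zero =>
    simp only [infPow, ne_eq, ite_eq_right_iff, one_ne_zero, imp_false, not_not] at hn
    exact hn ▸ hy
  | succ n ih =>
    simp only [infPow, ne_eq, ENNReal.tsum_eq_zero, not_forall, mul_eq_zero, not_or] at hn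
    obtain ⟨y'', h₁, h₂⟩ := hn
    exact h y'' (ih y'' h₁) y' h₂

/-! ### Exponential estimates and subinvariant vectors -/

theorem limsup_log_le_of_le_exp {q : ℕ → ℝ≥0∞} {K m : ℝ}
    (h : ∀ N : ℕ, q N ≤ ENNReal.ofReal (Real.exp (K - m * N))) :
    Filter.limsup (fun N : ℕ => ((1 / (N : ℝ) : ℝ) : EReal) * ENNReal.log (q N)) Filter.atTop
      ≤ ((-m : ℝ) : EReal) := by
  have ht : Filter.Tendsto (fun N : ℕ => (((K / N - m : ℝ)) : EReal)) Filter.atTop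
      (nhds ((-m : ℝ) : EReal)) := by
    refine (continuous_coe_real_ereal.tendsto _).comp ?_
    simpa using (tendsto_const_div_atTop_nhds_zero_nat K).sub_const m
  rw [← ht.limsup_eq]
  refine Filter.limsup_le_limsup ?_
  filter_upwards [Filter.eventually_gt_atTop 0] with N hN
  have hN' : (0 : ℝ) < N := by exact_mod_cast hN
  calc ((1 / (N : ℝ) : ℝ) : EReal) * ENNReal.log (q N)
      ≤ ((1 / (N : ℝ) : ℝ) : EReal) * ((K - m * N : ℝ) : EReal) := by
        refine mul_le_mul_of_nonneg_left ?_ (by exact_mod_cast (by positivity : 0 ≤ 1 / (N : ℝ)))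
        refine (ENNReal.log_le_log (h N)).trans_eq ?_
        rw [ENNReal.log_ofReal_of_pos (Real.exp_pos _), Real.log_exp]
    _ = ((K / N - m : ℝ) : EReal) := by
        rw [← EReal.coe_mul]; congr 1; field_simp

theorem le_ofReal_exp_convex_comb {q : ℝ≥0∞} {a b t : ℝ} (ht₀ : 0 ≤ t) (ht₁ : t ≤ 1)
    (ha : q ≤ ENNReal.ofReal (Real.exp a)) (hb : q ≤ ENNReal.ofReal (Real.exp b)) :
    q ≤ ENNReal.ofReal (Real.exp ((1 - t) * a + t * b)) := by
  rcases le_total a b with h | h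
  · refine ha.trans (ENNReal.ofReal_le_ofReal (Real.exp_le_exp.2 ?_)); nlinarith
  · refine hb.trans (ENNReal.ofReal_le_ofReal (Real.exp_le_exp.2 ?_)); nlinarith

/-- The constant `K` must not depend on `c`, since `c` will carry the linear dependence on the
target level. -/
theorem tsum_ofReal_exp_sub_mul {r : ℝ} (hr : 0 < r) :
    ∃ K : ℝ, ∀ c : ℝ, ∑' n : ℕ, ENNReal.ofReal (Real.exp (c - r * n)) =
      ENNReal.ofReal (Real.exp (K + c)) := by
  have hs : Summable fun n : ℕ => Real.exp (-r) ^ n :=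
    summable_geometric_of_lt_one (Real.exp_pos _).le (by simpa using hr)
  have hpos : 0 < ∑' n : ℕ, Real.exp (-r) ^ n :=
    hs.tsum_pos (fun n => by positivity) 0 (by simp)
  refine ⟨Real.log (∑' n : ℕ, Real.exp (-r) ^ n), fun c => ?_⟩
  have he : ∀ n : ℕ, Real.exp (c - r * n) = Real.exp c * Real.exp (-r) ^ n := fun n => by
    rw [← Real.exp_nat_mul, ← Real.exp_add]; ring_nf
  simp only [he]
  rw [← ENNReal.ofReal_tsum_of_nonneg (fun n => by positivity) (hs.mul_left _), tsum_mul_left,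
    Real.exp_add, Real.exp_log hpos, mul_comm]

/-- Take `v = ∑ₙ zⁿ Aⁿ 1`. Shifting the index gives `A v = z⁻¹ (v - 1) ≤ z⁻¹ v`, and the term `n =
0` makes `v` positive. -/
theorem exists_mulVec_le_of_summable {S : Type*} [Fintype S] [DecidableEq S] {A : Matrix S S ℝ}
    (hA : ∀ i j, 0 ≤ A i j) {z : ℝ} (hz : 0 < z)
    (h : ∀ i j, Summable fun n : ℕ => z ^ n * (A ^ n) i j) :
    ∃ v : S → ℝ, (∀ j, 0 < v j) ∧ ∀ j, A.mulVec v j ≤ z⁻¹ * v j := by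
  have hpow : ∀ n i j, 0 ≤ (A ^ n) i j := by
    intro n
    induction n with
    | zero => intro i j; simp only [pow_zero, Matrix.one_apply]; split_ifs <;> norm_num
    | succ n ih =>
      intro i j
      rw [pow_succ, Matrix.mul_apply]
      exact Finset.sum_nonneg fun k _ => mul_nonneg (ih i k) (hA k j)
  set u : ℕ → S → ℝ := fun n j => ∑ l, z ^ n * (A ^ n) j l with hu
  have hus : ∀ j, Summable fun n => u n j := fun j => summable_sum fun l _ => h j l
  have hu0 : ∀ n j, 0 ≤ u n j := fun n j =>
    Finset.sum_nonneg fun l _ => mul_nonneg (by positivity) (hpow n j l)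
  have hu00 : ∀ j, u 0 j = 1 := fun j => by simp [hu, Matrix.one_apply]
  have hstep : ∀ n j, ∑ k, A j k * u n k = z⁻¹ * u (n + 1) j := by
    intro n j
    simp only [hu, pow_succ' A, Matrix.mul_apply, Finset.mul_sum]
    rw [Finset.sum_comm]
    refine Finset.sum_congr rfl fun l _ => Finset.sum_congr rfl fun k _ => ?_
    rw [pow_succ]; field_simp
  refine ⟨fun j => ∑' n, u n j, fun j => ?_, fun j => ?_⟩
  · exact (hus j).tsum_pos (fun n => hu0 n j) 0 (by simp [hu00])
  · have : A.mulVec (fun j => ∑' n, u n j) j = z⁻¹ * ∑' n, u (n + 1) j := by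
      simp only [Matrix.mulVec, dotProduct, ← tsum_mul_left]
      rw [← Summable.tsum_finsetSum fun k _ => (hus k).mul_left _]
      simp only [hstep]
    rw [this]
    dsimp only
    rw [(hus j).tsum_eq_zero_add, hu00]
    have : 0 < z⁻¹ := by positivity
    exact mul_le_mul_of_nonneg_left (by linarith) this.le

/-! ### Transition blocks and exponential test functions -/

namespace MMRW3

variable {S₀ : Type*}

theorem Astar_exp_apply (W : MMRW3 S₀) (s : Fin 3 → ℝ) (j j' : S₀) :
    W.Astar (fun i => Real.exp (s i)) j j' =
      ∑ k ∈ incr3, Real.exp (∑ i, s i * k i) * W.P (0, j) (k, j') := by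
  simp only [Astar, Matrix.sum_apply, Matrix.smul_apply, smul_eq_mul, A]
  refine Finset.sum_congr rfl fun k _ => ?_
  rw [Real.exp_sum]
  congr 1
  refine Finset.prod_congr rfl fun i _ => ?_
  rw [← Real.rpow_intCast, ← Real.exp_mul]

theorem Astar_exp_nonneg (W : MMRW3 S₀) (s : Fin 3 → ℝ) (j j' : S₀) :
    0 ≤ W.Astar (fun i => Real.exp (s i)) j j' := by
  rw [Astar_exp_apply]
  exact Finset.sum_nonneg fun k _ => mul_nonneg (Real.exp_pos _).le (W.nonneg _ _)

theorem Astar_one_apply (W : MMRW3 S₀) (j j' : S₀) :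
    W.Astar 1 j j' = ∑ k ∈ incr3, W.P (0, j) (k, j') := by
  simp [Astar, Matrix.sum_apply, A]

theorem P_zero_eq_zero (W : MMRW3 S₀) {k : Fin 3 → ℤ} (hk : k ∉ incr3) (j j' : S₀) :
    W.P (0, j) (k, j') = 0 := by
  by_contra h
  exact hk (by simpa using W.skip_free 0 j k j' h)

theorem Q_eq (W : MMRW3 S₀) (y y' : (Fin 3 → ℕ) × S₀) :
    W.Q y y' = ENNReal.ofReal (W.P (0, y.2) (fun i => (y'.1 i : ℤ) - y.1 i, y'.2)) := by
  rw [Q, ← W.homogeneous (fun i => (y.1 i : ℤ)) 0]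
  congr 2
  · simp
  · congr 1; ext i; simp

variable [Fintype S₀]

theorem sum_Astar_one (W : MMRW3 S₀) (j : S₀) : ∑ j', W.Astar 1 j j' = 1 := by
  have h := hasSum_sum_of_ne_finset_zero (L := SummationFilter.unconditional _) (f := W.P (0, j))
    (s := incr3 ×ˢ Finset.univ) (by
    rintro ⟨k, j'⟩ hk
    exact W.P_zero_eq_zero (by simpa using hk) j j')
  rw [← h.unique (W.hasSum_row _), Finset.sum_product_right]
  simp only [Astar_one_apply]

theorem driftMatrix_mulVec_one (W : MMRW3 S₀) (i : Fin 3) (j : S₀) :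
    (-W.marginal i (-1) + W.marginal i 1).mulVec 1 j =
      ∑ j', ∑ k ∈ incr3, (k i : ℝ) * W.P (0, j) (k, j') := by
  simp only [Matrix.mulVec, dotProduct, Pi.one_apply, mul_one, Matrix.add_apply,
    Matrix.neg_apply, marginal, Matrix.sum_apply, Finset.sum_filter]
  refine Finset.sum_congr rfl fun j' _ => ?_
  rw [← Finset.sum_neg_distrib, ← Finset.sum_add_distrib]
  refine Finset.sum_congr rfl fun k hk => ?_
  have : k i = -1 ∨ k i = 0 ∨ k i = 1 := by
    simpa using Fintype.mem_piFinset.1 hk i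
  rcases this with h | h | h <;> simp [h, A]

/-- If `v` is superharmonic for `A_{***}(e^s)`, then `(x, j) ↦ e^{s·x} v_j` is superharmonic
for `Q`. -/
theorem tsum_Q_mul_le (W : MMRW3 S₀) {s : Fin 3 → ℝ} {v : S₀ → ℝ} {c : ℝ} (hv : ∀ j, 0 < v j)
    (h : ∀ j, (W.Astar fun i => Real.exp (s i)).mulVec v j ≤ Real.exp c * v j)
    (y : (Fin 3 → ℕ) × S₀) :
    ∑' y', W.Q y y' * ENNReal.ofReal (Real.exp (∑ i, s i * y'.1 i) * v y'.2) ≤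
      ENNReal.ofReal (Real.exp c) * ENNReal.ofReal (Real.exp (∑ i, s i * y.1 i) * v y.2) := by
  obtain ⟨x, j⟩ := y
  set E := Real.exp (∑ i, s i * x i) with hE
  set g : (Fin 3 → ℤ) × S₀ → ℝ := fun w =>
    E * (Real.exp (∑ i, s i * w.1 i) * W.P (0, j) w * v w.2) with hg
  have hg0 : ∀ w, 0 ≤ g w := fun w => by
    have := W.nonneg (0, j) w
    have := (hv w.2).le
    positivity
  set φ : (Fin 3 → ℕ) × S₀ → (Fin 3 → ℤ) × S₀ := fun y' => (fun i => (y'.1 i : ℤ) - x i, y'.2)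
  have hφ : Function.Injective φ := by
    rintro ⟨a, b⟩ ⟨a', b'⟩ hab
    simp only [φ, Prod.mk.injEq] at hab
    refine Prod.ext (funext fun i => ?_) hab.2
    have := congrFun hab.1 i
    dsimp only at this ⊢
    omega
  calc ∑' y', W.Q (x, j) y' * ENNReal.ofReal (Real.exp (∑ i, s i * y'.1 i) * v y'.2)
      = ∑' y', ENNReal.ofReal (g (φ y')) := by
        congr 1; ext y'
        rw [Q_eq, ← ENNReal.ofReal_mul (W.nonneg _ _)]
        congr 1
        have : Real.exp (∑ i, s i * y'.1 i) = E * Real.exp (∑ i, s i * ((φ y').1 i : ℝ)) := by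
          rw [hE, ← Real.exp_add, ← Finset.sum_add_distrib]
          congr 1
          refine Finset.sum_congr rfl fun i _ => ?_
          simp only [φ]; push_cast; ring
        rw [this]
        simp only [hg, φ]
        ring
    -- Passing from the octant to the whole lattice only adds nonnegative terms.
    _ ≤ ∑' w, ENNReal.ofReal (g w) :=
        ENNReal.tsum_comp_le_tsum_of_injective hφ fun w => ENNReal.ofReal (g w)
    _ = ∑ w ∈ incr3 ×ˢ Finset.univ, ENNReal.ofReal (g w) := by
        refine tsum_eq_sum ?_
        rintro ⟨k, j'⟩ hk
        simp [hg, W.P_zero_eq_zero (k := k) (by simpa using hk) j j']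
    _ = ENNReal.ofReal (E * (W.Astar fun i => Real.exp (s i)).mulVec v j) := by
        rw [← ENNReal.ofReal_sum_of_nonneg fun w _ => hg0 w, Finset.sum_product_right]
        simp only [hg, Matrix.mulVec, dotProduct, Astar_exp_apply, Finset.mul_sum, Finset.sum_mul]
    _ ≤ ENNReal.ofReal (E * (Real.exp c * v j)) := by
        refine ENNReal.ofReal_le_ofReal (mul_le_mul_of_nonneg_left (h j) (Real.exp_pos _).le)
    _ = _ := by
        rw [← ENNReal.ofReal_mul (Real.exp_pos _).le]; congr 1; ring

/-! ### Growth bounds, the Poisson equation and the effect of negative drift -/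

variable [DecidableEq S₀]

theorem infPow_Q_le (W : MMRW3 S₀) {s : Fin 3 → ℝ} {v : S₀ → ℝ} {c : ℝ} (hv : ∀ j, 0 < v j)
    (h : ∀ j, (W.Astar fun i => Real.exp (s i)).mulVec v j ≤ Real.exp c * v j)
    (y y' : (Fin 3 → ℕ) × S₀) (n : ℕ) :
    infPow W.Q n y y' ≤ ENNReal.ofReal (Real.exp (c * n + ∑ i, s i * y.1 i + Real.log (v y.2)
      - ∑ i, s i * y'.1 i - Real.log (v y'.2))) := by
  have hb := (ENNReal.le_tsum y').trans (tsum_infPow_mul_le (W.tsum_Q_mul_le hv h) n y)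
  have hpos : 0 < Real.exp (∑ i, s i * y'.1 i) * v y'.2 := mul_pos (Real.exp_pos _) (hv _)
  rw [← ENNReal.ofReal_pow (Real.exp_pos _).le, ← ENNReal.ofReal_mul (by positivity)] at hb
  rw [← ENNReal.le_div_iff_mul_le (Or.inl (by simpa using hpos)) (Or.inl ENNReal.ofReal_ne_top),
    ← ENNReal.ofReal_div_of_pos hpos] at hb
  refine hb.trans_eq (congrArg _ ?_)
  rw [Real.exp_sub, Real.exp_sub, Real.exp_add, Real.exp_add, Real.exp_log (hv _),
    Real.exp_log (hv _), mul_comm c, Real.exp_nat_mul, div_div, mul_assoc]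

/-- Membership only says that the convergence parameter is at least `1`, and the series may diverge
at `1` itself; the slack `c > 0` leaves room for a convergent `z > e^{-c}`. -/
theorem exists_superharmonic_of_mem_Gammabar (W : MMRW3 S₀) {s : Fin 3 → ℝ}
    (hs : s ∈ W.Gammabar) {c : ℝ} (hc : 0 < c) :
    ∃ v : S₀ → ℝ, (∀ j, 0 < v j) ∧
      ∀ j, (W.Astar fun i => Real.exp (s i)).mulVec v j ≤ Real.exp c * v j := by
  have h1 : 1 ≤ convParam (W.Astar fun i => Real.exp (s i)) := ENNReal.inv_le_one.1 hs
  have hlt : ENNReal.ofReal (Real.exp (-c)) < convParam (W.Astar fun i => Real.exp (s i)) :=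
    lt_of_lt_of_le (by simpa using hc) h1
  simp only [convParam, lt_iSup_iff] at hlt
  obtain ⟨z, hz, hlt⟩ := hlt
  have hlt' : Real.exp (-c) < z := by
    rw [ENNReal.ofReal_lt_iff_lt_toReal (Real.exp_pos _).le ENNReal.coe_ne_top] at hlt
    simpa using hlt
  have hz0 : (0 : ℝ) < z := (Real.exp_pos _).trans hlt'
  obtain ⟨v, hv, hAv⟩ := exists_mulVec_le_of_summable (W.Astar_exp_nonneg s) hz0 hz
  refine ⟨v, hv, fun j => (hAv j).trans (mul_le_mul_of_nonneg_right ?_ (hv j).le)⟩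
  rw [Real.exp_neg] at hlt'
  exact inv_le_of_inv_le₀ (Real.exp_pos _) hlt'.le

/-- Functions harmonic for the phase process are constant. -/
theorem eq_of_Astar_one_mulVec_eq (W : MMRW3 S₀) (hirr : InfIrreducible W.Q) {h : S₀ → ℝ}
    (hh : (W.Astar 1).mulVec h = h) (j j' : S₀) : h j = h j' := by
  have : Nonempty S₀ := ⟨j⟩
  obtain ⟨m, hm⟩ := Finite.exists_max h
  have key : ∀ j', h j' = h m := by
    intro j'
    obtain ⟨n, hn⟩ := hirr (0, m) (0, j')
    -- Maximum principle: at a maximum, `h` equals its average, so every phase reachable in one step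
    -- is again a maximum.
    refine mem_of_infPow_ne_zero (M := {y : (Fin 3 → ℕ) × S₀ | h y.2 = h m}) ?_ n rfl _ hn.ne'
    rintro ⟨x, a⟩ ha ⟨x', b⟩ hQ
    simp only [Set.mem_ofPred_eq] at ha ⊢
    have hsum : ∑ l, W.Astar 1 a l * (h a - h l) = 0 := by
      simp only [mul_sub, Finset.sum_sub_distrib, ← Finset.sum_mul, W.sum_Astar_one, one_mul]
      have := congrFun hh a
      simp only [Matrix.mulVec, dotProduct] at this
      linarith
    have hA0 : ∀ l, 0 ≤ W.Astar 1 a l := fun l => by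
      rw [Astar_one_apply]; exact Finset.sum_nonneg fun k _ => W.nonneg _ _
    rw [Finset.sum_eq_zero_iff_of_nonneg fun l _ =>
      mul_nonneg (hA0 l) (sub_nonneg.2 (by rw [ha]; exact hm l))] at hsum
    have hab : 0 < W.Astar 1 a b := by
      rw [Q_eq] at hQ
      have hP := ENNReal.ofReal_pos.1 (pos_iff_ne_zero.2 hQ)
      rw [Astar_one_apply]
      refine hP.trans_le (Finset.single_le_sum (f := fun k => W.P (0, a) (k, b))
        (fun k _ => W.nonneg _ _) ?_)
      by_contra hk
      exact hP.ne' (W.P_zero_eq_zero hk a b)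
    have := (mul_eq_zero.1 (hsum b (Finset.mem_univ _))).resolve_left hab.ne'
    linarith
  rw [key j, key j']

/-- Solvability of the Poisson equation for the phase process. -/
theorem exists_poisson (W : MMRW3 S₀) (hirr : InfIrreducible W.Q) {p : S₀ → ℝ}
    (hp : W.IsStationary p) {d : S₀ → ℝ} (hd : p ⬝ᵥ d = 0) :
    ∃ h : S₀ → ℝ, h - (W.Astar 1).mulVec h = d := by
  obtain ⟨-, hp1, hpA⟩ := hp
  let T : (S₀ → ℝ) →ₗ[ℝ] (S₀ → ℝ) := LinearMap.id - (W.Astar 1).mulVecLin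
  let φ : (S₀ → ℝ) →ₗ[ℝ] ℝ := dotProductBilin ℝ ℝ p
  have hT : ∀ h, T h = h - (W.Astar 1).mulVec h := fun h => rfl
  have hφ : ∀ h, φ h = p ⬝ᵥ h := fun h => rfl
  have hle : LinearMap.range T ≤ LinearMap.ker φ := by
    rintro _ ⟨h, rfl⟩
    rw [LinearMap.mem_ker, hφ, hT, dotProduct_sub, Matrix.dotProduct_mulVec, hpA, sub_self]
  have hker : LinearMap.ker T ≤ Submodule.span ℝ {(1 : S₀ → ℝ)} := by
    intro h hh
    rw [LinearMap.mem_ker, hT, sub_eq_zero] at hh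
    rw [Submodule.mem_span_singleton]
    rcases isEmpty_or_nonempty S₀ with _ | ⟨⟨j⟩⟩
    · exact ⟨0, Subsingleton.elim _ _⟩
    · exact ⟨h j, funext fun l => by simpa using W.eq_of_Astar_one_mulVec_eq hirr hh.symm j l⟩
  have h1 := (Submodule.finrank_mono hker).trans (finrank_span_le_card (R := ℝ) _)
  rw [Set.toFinset_card, Set.card_singleton] at h1
  have hsurj : LinearMap.range φ = ⊤ := by
    refine LinearMap.range_eq_top.2 fun c => ⟨fun _ => c, ?_⟩
    simp [hφ, dotProduct, ← Finset.sum_mul, hp1]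
  have h2 := LinearMap.finrank_range_add_finrank_ker T
  have h3 := LinearMap.finrank_range_add_finrank_ker φ
  rw [hsurj, finrank_top, Module.finrank_self] at h3
  -- The kernel of `I - A` has dimension at most one, so its range has codimension at most one and
  -- fills the hyperplane orthogonal to `p`.
  have heq := Submodule.eq_of_le_of_finrank_le hle (by omega)
  have : d ∈ LinearMap.range T := heq ▸ (by rw [LinearMap.mem_ker, hφ, hd])
  obtain ⟨h, hh⟩ := this
  exact ⟨h, hh⟩

/-- A negative drift yields a point at which `A_{***}` has spectral radius less than one. -/
theorem exists_strict_superharmonic (W : MMRW3 S₀) (hirr : InfIrreducible W.Q) {p : S₀ → ℝ}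
    (hp : W.IsStationary p) {i : Fin 3} (hi : W.drift p i < 0) :
    ∃ (s : Fin 3 → ℝ) (v : S₀ → ℝ) (r : ℝ), 0 < r ∧ (∀ j, 0 < v j) ∧
      ∀ j, (W.Astar fun i => Real.exp (s i)).mulVec v j ≤ Real.exp (-r) * v j := by
  set a := W.drift p i with ha
  set d := (-W.marginal i (-1) + W.marginal i 1).mulVec 1 with hd
  obtain ⟨h, hh⟩ := W.exists_poisson hirr hp (d := d - fun _ => a) (by
    rw [dotProduct_sub, sub_eq_zero]
    change a = _
    simp [dotProduct, ← Finset.sum_mul, hp.2.1])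
  let s : ℝ → Fin 3 → ℝ := fun ε => Pi.single i ε
  -- To first order in `ε`, the Poisson equation gives `A_{***}(e^{ε e_i})(1 + ε h) ≈ 1 + ε (h +
  -- a)`, against `1 + ε (h + a/2)` for the target. So `F` has derivative `-a/2 > 0` at `0`; halving
  -- `a` absorbs the remainder.
  let F : S₀ → ℝ → ℝ := fun j ε => Real.exp (ε * (a / 2)) * (1 + ε * h j) -
    ∑ j', (∑ k ∈ incr3, Real.exp (ε * k i) * W.P (0, j) (k, j')) * (1 + ε * h j')
  have hF0 : ∀ j, F j 0 = 0 := fun j => by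
    simp [F, ← W.Astar_one_apply, W.sum_Astar_one]
  have hlin : ∀ j, HasDerivAt (fun ε : ℝ => 1 + ε * h j) (h j) 0 := fun j => by
    simpa using ((hasDerivAt_id (0 : ℝ)).mul_const (h j)).const_add 1
  have hexp : ∀ b : ℝ, HasDerivAt (fun ε : ℝ => Real.exp (ε * b)) b 0 := fun b => by
    simpa using ((hasDerivAt_id (0 : ℝ)).mul_const b).exp
  have hF' : ∀ j, HasDerivAt (F j) (-(a / 2)) 0 := by
    intro j
    have h1 := (hexp (a / 2)).fun_mul (hlin j)
    have h2 := HasDerivAt.fun_sum (u := Finset.univ) fun j' _ =>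
      (HasDerivAt.fun_sum (u := incr3) fun k _ =>
        (hexp (k i)).mul_const (W.P (0, j) (k, j'))).fun_mul (hlin j')
    refine (h1.fun_sub h2).congr_deriv ?_
    have hhj := congrFun hh j
    have hdj := W.driftMatrix_mulVec_one i j
    rw [← hd] at hdj
    simp only [Pi.sub_apply, Matrix.mulVec, dotProduct] at hhj
    simp only [zero_mul, Real.exp_zero, one_mul, add_zero, mul_one, Finset.sum_add_distrib,
      ← W.Astar_one_apply, ← hdj]
    linarith
  have hev : ∀ j, ∀ᶠ ε in nhdsWithin (0 : ℝ) (Set.Ioi 0), 0 < F j ε := by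
    intro j
    have := (hasDerivAt_iff_tendsto_slope_zero.1 (hF' j)).mono_left
      (nhdsWithin_mono 0 (fun x (hx : 0 < x) => hx.ne'))
    filter_upwards [this.eventually (lt_mem_nhds (show 0 < -(a / 2) by linarith)),
      self_mem_nhdsWithin] with ε hε hpos
    simp only [zero_add, hF0, sub_zero, smul_eq_mul] at hε
    exact pos_of_mul_pos_right hε (inv_pos.2 hpos).le
  have hev' : ∀ j, ∀ᶠ ε in nhdsWithin (0 : ℝ) (Set.Ioi 0), 0 < 1 + ε * h j := by
    intro j
    have := (hlin j).continuousAt.tendsto.mono_left (nhdsWithin_le_nhds (s := Set.Ioi 0))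
    exact this.eventually (lt_mem_nhds (by simp))
  obtain ⟨ε, ⟨hε, hε1⟩, hε2⟩ := ((Filter.eventually_all.2 hev).and
    (Filter.eventually_all.2 hev') |>.and self_mem_nhdsWithin).exists
  have hε0 : 0 < ε := hε2
  refine ⟨s ε, fun j => 1 + ε * h j, -(ε * (a / 2)), by nlinarith, hε1, fun j => ?_⟩
  have hs : ∀ k : Fin 3 → ℤ, ∑ l, s ε l * (k l : ℝ) = ε * k i := fun k => by
    simp [s, Pi.single_apply]
  have := hε j
  simp only [Matrix.mulVec, dotProduct, Astar_exp_apply, hs, neg_neg]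
  simp only [F] at this
  linarith

theorem limsup_log_Qtilde_le (W : MMRW3 S₀) {s s' : Fin 3 → ℝ} {v' : S₀ → ℝ} {r t : ℝ}
    (hs : s ∈ W.Gammabar) (hr : 0 < r) (hv' : ∀ j, 0 < v' j)
    (h' : ∀ j, (W.Astar fun i => Real.exp (s' i)).mulVec v' j ≤ Real.exp (-r) * v' j)
    (ht₀ : 0 < t) (ht₁ : t < 1) (y : (Fin 3 → ℕ) × S₀) (x' : Fin 3 → ℕ) (j' : S₀) (i : Fin 3) :
    Filter.limsup
      (fun n : ℕ => ((1 / (n : ℝ) : ℝ) : EReal) *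
        ENNReal.log (W.Qtilde y (Function.update x' i n, j')))
      Filter.atTop ≤ ((-((1 - t) * s i + t * s' i) : ℝ) : EReal) := by
  -- With slack `c = t r`, the combined exponent per step is `(1 - t) t r - t r = -t² r`.
  obtain ⟨v, hv, h⟩ := W.exists_superharmonic_of_mem_Gammabar hs (mul_pos ht₀ hr)
  obtain ⟨K, hK⟩ := tsum_ofReal_exp_sub_mul (r := t ^ 2 * r) (by positivity)
  have hupd : ∀ (u : Fin 3 → ℝ) (N : ℕ), ∑ l, u l * ((Function.update x' i N l : ℕ) : ℝ) =
      u i * N + ∑ l ∈ Finset.univ.erase i, u l * (x' l : ℝ) := by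
    intro u N
    rw [← Finset.add_sum_erase _ _ (Finset.mem_univ i), Function.update_self]
    congr 1
    refine Finset.sum_congr rfl fun l hl => ?_
    rw [Function.update_of_ne (Finset.ne_of_mem_erase hl)]
  let B : (Fin 3 → ℝ) → (S₀ → ℝ) → ℝ := fun u w => ∑ l, u l * (y.1 l : ℝ) + Real.log (w y.2) -
    ∑ l ∈ Finset.univ.erase i, u l * (x' l : ℝ) - Real.log (w j')
  refine limsup_log_le_of_le_exp (K := K + ((1 - t) * B s v + t * B s' v')) fun N => ?_
  refine (ENNReal.tsum_le_tsum fun n => ?_).trans_eq ((hK ((1 - t) * B s v + t * B s' v' -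
    ((1 - t) * s i + t * s' i) * N)).trans (by rw [← add_sub_assoc]))
  refine (le_ofReal_exp_convex_comb ht₀.le ht₁.le (W.infPow_Q_le hv h y _ n)
    (W.infPow_Q_le hv' h' y _ n)).trans_eq ?_
  rw [hupd, hupd]
  simp only [B]
  ring_nf

end MMRW3

theorem mainTheorem2 {S₀ : Type*} [Fintype S₀] [DecidableEq S₀] (W : MMRW3 S₀)
    (p : S₀ → ℝ) (hp : W.IsStationary p)
    (hdrift : ∀ i, W.drift p i ≠ 0) (hneg : ∃ i, W.drift p i < 0)
    (hirr : InfIrreducible W.Q) (haper : InfAperiodic W.Q)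
    (hup : ∀ i r, ∃ c, 0 < W.upBlock i r c)
    (y : (Fin 3 → ℕ) × S₀) (x' : Fin 3 → ℕ) (j' : S₀) (i : Fin 3) :
    Filter.limsup
      (fun n : ℕ => ((1 / (n : ℝ) : ℝ) : EReal) *
        ENNReal.log (W.Qtilde y (Function.update x' i n, j')))
      Filter.atTop ≤ -W.smax i := by
  obtain ⟨i₀, hi₀⟩ := hneg
  obtain ⟨s', v', r, hr, hv', h'⟩ := W.exists_strict_superharmonic hirr hp hi₀
  rw [EReal.le_neg]
  refine iSup₂_le fun s hs => ?_
  rw [EReal.le_neg, ← EReal.coe_neg]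
  have hlim : Filter.Tendsto (fun t : ℝ => ((-((1 - t) * s i + t * s' i) : ℝ) : EReal))
      (nhdsWithin 0 (Set.Ioi 0)) (nhds ((-s i : ℝ) : EReal)) := by
    refine (continuous_coe_real_ereal.tendsto _).comp
      (Filter.Tendsto.mono_left ?_ nhdsWithin_le_nhds)
    have : Continuous fun t : ℝ => -((1 - t) * s i + t * s' i) := by fun_prop
    simpa using this.tendsto 0
  refine ge_of_tendsto hlim ?_
  filter_upwards [Ioo_mem_nhdsGT (zero_lt_one' ℝ)] with t ht
  exact W.limsup_log_Qtilde_le hs hr hv' h' ht.1 ht.2 y x' j' i
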